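/- **Theorem (Schmidt quantum compressor).** A circuit is a finite list of gates, each an arbitrary one-qubit unitary or a CNOT, without ancilla qubits; its CNOT count is the number of CNOTs in it. There are a synthesis method $S$ and a constant $K$ with the following properties. (i) For all integers $s\ge 1$ and $0\le m\le s$ and every $2^s\times 2^m$ complex matrix $W$ with $W^\dagger W=I$ (a state vector if $m=0$, an isometry if $m<s$, a unitary if $m=s$), $S$ gives a circuit on $s$ qubits that encodes the inverse of $W$, i.e. whose operator maps the $j$-th column of $W$ to the computational basis state $|j\rangle$ for every $0\le j<2^m$. (ii) Let $|\psi\rangle$ be any unit vector on $n$ qubits, and let the qubits be split in any way into a block A of $n_A$ qubits and a block B of $n_B$ qubits, each listed in any order, with $n_A+n_B=n$ and $1\le n_B\le n_A$. Let $M_\psi=U\Sigma V^\dagger$ be any singular value decomposition, with singular values in decreasing order, of the $2^{n_A}\times 2^{n_B}$ matrix of amplitudes of $|\psi\rangle$. Equivalently, $|\psi\rangle=\sum_{i=1}^{k}\lambda_i|u_i\rangle_A|v_i\rangle_B$ is a Schmidt decomposition, where $\lambda_1\ge\dots\ge\lambda_k>0$ are the nonzero singular values and $u_i$, $v_i$ are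 the $i$-th columns of $U$ and of the complex conjugate $V^*$. Let $m=\lceil\log_2 k\rceil$ be the Schmidt measure; then $0\le m\le n_B$. The SQC compressor circuit applies the circuit that $S$ gives for the inverse of the first $2^m$ columns of $U$ on A, then the one that $S$ gives for the inverse of the first $2^m$ columns of $V^*$ on B, and then $m$ CNOTs, the $i$-th controlled by the $i$-th qubit of A and targeting the $i$-th qubit of B (the $i$-th qubit of a block carries the bit of weight $2^{i-1}$). Its CNOT count is - at most $K\,2^{m+n_A}$, that is $O(2^{m+n_A})$, if $0\le m<n_B$; - at most $K\,2^{n}$, that is $O(2^{n})$, if $m=n_B$. The constant $K$ does not depend on $n,n_A,n_B,m$, the state, the bipartition or the decomposition. -/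

import Mathlib

namespace SQC

/-! Qubit registers, circuits over one-qubit gates and CNOT, and the Schmidt quantum compressor.
A register with qubits indexed by `Q` has computational basis `Q → Fin 2`. -/

/-- Elementary gates on a register with qubits `Q`: arbitrary one-qubit unitaries and CNOTs
(control `c`, target `t`). -/
inductive Gate (Q : Type) : Type where
  | single (q : Q) (u : Matrix.unitaryGroup (Fin 2) ℂ) : Gate Q
  | cnot (c t : Q) (h : c ≠ t) : Gate Q

/-- The operator of a gate, as a matrix in the computational basis: the entry at `(x, y)` is
`⟨x| G |y⟩`. -/
def Gate.toMatrix {Q : Type} [Fintype Q] [DecidableEq Q] :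
    Gate Q → Matrix (Q → Fin 2) (Q → Fin 2) ℂ
  | .single q u => Matrix.of fun x y =>
      if ∀ r, r ≠ q → x r = y r then (u : Matrix (Fin 2) (Fin 2) ℂ) (x q) (y q) else 0
  | .cnot c t _ => Matrix.of fun x y =>
      if x = Function.update y t (y t + y c) then 1 else 0

/-- The same gate acting on the qubits `f q` of a larger register. -/
def Gate.map {P Q : Type} (f : P ↪ Q) : Gate P → Gate Q
  | .single q u => .single (f q) u
  | .cnot c t h => .cnot (f c) (f t) (f.injective.ne h)

/-- The number of CNOTs in a gate, `0` or `1`. -/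
def Gate.cnotCost {Q : Type} : Gate Q → ℕ
  | .single _ _ => 0
  | .cnot _ _ _ => 1

/-- A circuit is a list of gates in the order in which they are applied; no ancilla qubits. -/
abbrev Circuit (Q : Type) : Type := List (Gate Q)

/-- The operator of a circuit: the head of the list acts first. -/
noncomputable def Circuit.toMatrix {Q : Type} [Fintype Q] [DecidableEq Q] :
    Circuit Q → Matrix (Q → Fin 2) (Q → Fin 2) ℂ
  | [] => 1
  | g :: C => Circuit.toMatrix C * g.toMatrix

/-- The number of CNOT gates of a circuit. -/
def Circuit.cnotCount {Q : Type} (C : Circuit Q) : ℕ := (C.map Gate.cnotCost).sum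

/-- The bit string of `i < 2 ^ s`; qubit `q` carries the bit of weight `2 ^ q`. -/
def bits (s : ℕ) (i : Fin (2 ^ s)) : Fin s → Fin 2 := finFunctionFinEquiv.symm i

/-- The circuit `C` on `s` qubits encodes the inverse of the `2^m`-to-`2^s` isometry `W`: it sends
the `j`-th column of `W` to the basis state `|j⟩`, for all `j < 2 ^ m`. For `m = s` this says that
the operator of `C` is `W⁻¹`; for `m = 0` it says that the inverse of `C` prepares the vector `W`
from `|0⟩`. -/
def EncodesInverse {s m : ℕ} (h : m ≤ s) (C : Circuit (Fin s))
    (W : Matrix (Fin (2 ^ s)) (Fin (2 ^ m)) ℂ) : Prop :=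
  ∀ j : Fin (2 ^ m),
    C.toMatrix.mulVec (fun x => W (finFunctionFinEquiv x) j) =
      Pi.single (bits s (Fin.castLE (Nat.pow_le_pow_right two_pos h) j)) 1

/-- A synthesis method assigns a circuit on `s` qubits to each `2^s × 2^m` matrix. -/
abbrev Synthesis : Type :=
  ∀ s m : ℕ, Matrix (Fin (2 ^ s)) (Fin (2 ^ m)) ℂ → Circuit (Fin s)

/-- The synthesis method is correct: it encodes the inverse of every vector (`m = 0`), isometry
(`m < s`) and unitary (`m = s`) on at least one qubit. -/
def Synthesis.Correct (S : Synthesis) : Prop :=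
  ∀ (s m : ℕ) (_ : 1 ≤ s) (h : m ≤ s) (W : Matrix (Fin (2 ^ s)) (Fin (2 ^ m)) ℂ),
    W.conjTranspose * W = 1 → EncodesInverse h (S s m W) W

/-- The `a × b` matrix with diagonal `σ`. -/
noncomputable def rectDiag {a b : ℕ} (σ : Fin (min a b) → ℝ) : Matrix (Fin a) (Fin b) ℂ :=
  Matrix.of fun i j =>
    if h : i.val = j.val then ((σ ⟨i.val, lt_min i.isLt (h ▸ j.isLt)⟩ : ℝ) : ℂ) else 0

/-- `M = U Σ V†` is a singular value decomposition, with the singular values in decreasing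
order. -/
structure IsSVD {a b : ℕ} (M : Matrix (Fin a) (Fin b) ℂ) (U : Matrix (Fin a) (Fin a) ℂ)
    (σ : Fin (min a b) → ℝ) (V : Matrix (Fin b) (Fin b) ℂ) : Prop where
  unitary_left : U ∈ Matrix.unitaryGroup (Fin a) ℂ
  unitary_right : V ∈ Matrix.unitaryGroup (Fin b) ℂ
  nonneg : ∀ i, 0 ≤ σ i
  antitone : Antitone σ
  eq : M = U * rectDiag σ * V.conjTranspose

/-- The state vector on `n` qubits reshaped into a `2^nA × 2^nB` matrix. The bipartition is `e`: it
says which qubit of the register is the `i`-th qubit of block A or of block B. -/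
def reshape {n nA nB : ℕ} (e : Fin nA ⊕ Fin nB ≃ Fin n)
    (ψ : EuclideanSpace ℂ (Fin n → Fin 2)) : Matrix (Fin (2 ^ nA)) (Fin (2 ^ nB)) ℂ :=
  Matrix.of fun i j => ψ fun q => Sum.elim (bits nA i) (bits nB j) (e.symm q)

/-- The Schmidt rank `k`: the number of nonzero Schmidt coefficients. -/
noncomputable def schmidtRank {d : ℕ} (σ : Fin d → ℝ) : ℕ :=
  (Finset.univ.filter fun i => σ i ≠ 0).card

/-- The Schmidt measure `m = ⌈log₂ k⌉`. -/
noncomputable def schmidtMeasure {d : ℕ} (σ : Fin d → ℝ) : ℕ := Nat.clog 2 (schmidtRank σ)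

theorem schmidtRank_le {d : ℕ} (σ : Fin d → ℝ) : schmidtRank σ ≤ d :=
  (Finset.card_le_univ _).trans (Fintype.card_fin d).le

theorem schmidtMeasure_le_left {nA nB : ℕ} (σ : Fin (min (2 ^ nA) (2 ^ nB)) → ℝ) :
    schmidtMeasure σ ≤ nA :=
  Nat.clog_le_of_le_pow ((schmidtRank_le σ).trans (min_le_left _ _))

theorem schmidtMeasure_le_right {nA nB : ℕ} (σ : Fin (min (2 ^ nA) (2 ^ nB)) → ℝ) :
    schmidtMeasure σ ≤ nB :=
  Nat.clog_le_of_le_pow ((schmidtRank_le σ).trans (min_le_right _ _))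

/-- The first `2 ^ m` columns of a `2^s × 2^s` matrix. -/
def firstColumns {s : ℕ} (m : ℕ) (h : m ≤ s) (U : Matrix (Fin (2 ^ s)) (Fin (2 ^ s)) ℂ) :
    Matrix (Fin (2 ^ s)) (Fin (2 ^ m)) ℂ :=
  U.submatrix id (Fin.castLE (Nat.pow_le_pow_right two_pos h))

/-- The CNOTs of the compressor: for `i < m`, controlled by the `i`-th qubit of A and targeting the
`i`-th qubit of B. -/
def cnotLayer {n nA nB : ℕ} (e : Fin nA ⊕ Fin nB ≃ Fin n) (m : ℕ) (hA : m ≤ nA) (hB : m ≤ nB) :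
    Circuit (Fin n) :=
  List.ofFn fun i : Fin m =>
    Gate.cnot (e (Sum.inl (Fin.castLE hA i))) (e (Sum.inr (Fin.castLE hB i)))
      (e.injective.ne Sum.inl_ne_inr)

/-- The circuit that the Schmidt quantum compressor protocol outputs for the singular value
decomposition `(U, σ, V)` of the reshaped state: with `m` the Schmidt measure, encode on block A the
inverse of the first `2 ^ m` columns of `U`, on block B the inverse of the first `2 ^ m` columns of
the entrywise conjugate `V*`, then apply `m` CNOTs. -/
noncomputable def compressor (S : Synthesis) {n nA nB : ℕ} (e : Fin nA ⊕ Fin nB ≃ Fin n)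
    (U : Matrix (Fin (2 ^ nA)) (Fin (2 ^ nA)) ℂ) (σ : Fin (min (2 ^ nA) (2 ^ nB)) → ℝ)
    (V : Matrix (Fin (2 ^ nB)) (Fin (2 ^ nB)) ℂ) : Circuit (Fin n) :=
  let m := schmidtMeasure σ
  let hA : m ≤ nA := schmidtMeasure_le_left σ
  let hB : m ≤ nB := schmidtMeasure_le_right σ
  List.map (Gate.map (Function.Embedding.inl.trans e.toEmbedding))
      (S nA m (firstColumns m hA U)) ++
    List.map (Gate.map (Function.Embedding.inr.trans e.toEmbedding))
      (S nB m (firstColumns m hB (V.map (starRingEnd ℂ)))) ++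
    cnotLayer e m hA hB

end SQC

namespace SQC

open Function
open scoped ComplexOrder

/-! Everything reduces to synthesizing an isometry from `m` to `s` qubits with `O(2 ^ (m + s))`
CNOTs. Its `2 ^ m` orthonormal columns are carried to basis states one at a time by complex
Householder reflections (`exists_householder_circuit`, `exists_circuit_mulVec_eq`), so each
reflection may cost `O(2 ^ s)`. A reflection is a conjugated phase: disentangle its axis to a
multiple of `|0⟩`, put a phase on `|0⟩`, undo (`exists_reflection_circuit`). Both ingredients are
built from multiplexed rotations, whose cost is linear in the number of control patterns
(`exists_multiplexed_circuit`). The compressor uses two such isometries and `m` further CNOTs. For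
`m = nB` the exponent `m + nA` equals `n`, so one bound serves both regimes. -/

theorem fin_two_add_add_cancel (a b : Fin 2) : a + b + b = a := by
  decide +revert

/-! ### Circuit operators: action on amplitudes, inverses, unitarity. -/

section Circuits

variable {Q : Type}

theorem eq_update_add_iff [DecidableEq Q] {c t : Q} (h : c ≠ t) (x y : Q → Fin 2) :
    x = update y t (y t + y c) ↔ y = update x t (x t + x c) := by
  have key : ∀ x y : Q → Fin 2, x = update y t (y t + y c) → y = update x t (x t + x c) := by
    rintro x y rfl
    simp [h, fin_two_add_add_cancel]
  exact ⟨key x y, key y x⟩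

/-- The inverse gate. -/
def Gate.inv : Gate Q → Gate Q
  | .single q u => .single q u⁻¹
  | .cnot c t h => .cnot c t h

/-- The inverse circuit. -/
def Circuit.inv (C : Circuit Q) : Circuit Q := (List.map Gate.inv C).reverse

theorem Circuit.cnotCount_append (C D : Circuit Q) :
    Circuit.cnotCount (C ++ D) = C.cnotCount + D.cnotCount := by
  simp [Circuit.cnotCount]

theorem Circuit.cnotCount_inv (C : Circuit Q) : C.inv.cnotCount = C.cnotCount := by
  have h : (Gate.cnotCost ∘ Gate.inv : Gate Q → ℕ) = Gate.cnotCost := by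
    ext g; cases g <;> rfl
  simp [Circuit.cnotCount, Circuit.inv, List.sum_reverse, h]

variable [Fintype Q] [DecidableEq Q]

/-- Row `x` is supported on the basis states `update x q b`. Later constructions compute with this
amplitude formula instead of with matrices. -/
theorem Gate.single_mulVec (q : Q) (u : Matrix.unitaryGroup (Fin 2) ℂ) (v : (Q → Fin 2) → ℂ)
    (x : Q → Fin 2) :
    (Gate.single q u).toMatrix.mulVec v x =
      ∑ b, (u : Matrix (Fin 2) (Fin 2) ℂ) (x q) b * v (update x q b) := by
  symm
  refine Finset.sum_of_injOn (fun b => update x q b) ?_ ?_ ?_ ?_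
  · exact (update_injective x q).injOn
  · simp
  · intro y _ hy
    have h : ¬ ∀ r, r ≠ q → x r = y r := by
      intro h
      refine hy ⟨y q, by simp, ?_⟩
      ext r
      by_cases hr : r = q
      · subst hr; simp
      · simp [hr, h r hr]
    simp [Gate.toMatrix, h]
  · intro b _
    have h : ∀ r, r ≠ q → x r = update x q b r := fun r hr => by simp [hr]
    simp only [Gate.toMatrix, Matrix.of_apply]
    rw [if_pos h]
    simp

theorem Gate.cnot_mulVec {c t : Q} (h : c ≠ t) (v : (Q → Fin 2) → ℂ) (x : Q → Fin 2) :
    (Gate.cnot c t h).toMatrix.mulVec v x = v (update x t (x t + x c)) := by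
  simp [Matrix.mulVec, dotProduct, Gate.toMatrix, eq_update_add_iff h x]

theorem Gate.inv_toMatrix_mul (g : Gate Q) : g.inv.toMatrix * g.toMatrix = 1 := by
  refine Matrix.ext_of_mulVec_single fun y => ?_
  rw [← Matrix.mulVec_mulVec, Matrix.one_mulVec]
  generalize (Pi.single y 1 : (Q → Fin 2) → ℂ) = v
  ext x
  cases g with
  | single q u =>
    have hu : ((u⁻¹ : Matrix.unitaryGroup (Fin 2) ℂ) : Matrix (Fin 2) (Fin 2) ℂ) *
        (u : Matrix (Fin 2) (Fin 2) ℂ) = 1 := by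
      rw [← Submonoid.coe_mul, inv_mul_cancel]; rfl
    simp only [Gate.inv, Gate.single_mulVec, update_self, update_idem, Finset.mul_sum]
    rw [Finset.sum_comm]
    simp_rw [← mul_assoc, ← Finset.sum_mul, ← Matrix.mul_apply, hu, Matrix.one_apply]
    simp
  | cnot c t h =>
    simp [Gate.inv, Gate.cnot_mulVec, h, fin_two_add_add_cancel]

theorem Gate.inv_toMatrix (g : Gate Q) : g.inv.toMatrix = g.toMatrix.conjTranspose := by
  cases g with
  | single q u =>
    ext x y
    simp only [Gate.inv, Gate.toMatrix, Matrix.of_apply, Matrix.conjTranspose_apply, apply_ite star,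
      star_zero, eq_comm]
    rfl
  | cnot c t h =>
    ext x y
    simp only [Gate.inv, Gate.toMatrix, Matrix.of_apply, Matrix.conjTranspose_apply, apply_ite star,
      star_zero, star_one, eq_update_add_iff h x]

theorem Circuit.toMatrix_append (C D : Circuit Q) :
    Circuit.toMatrix (C ++ D) = D.toMatrix * C.toMatrix := by
  induction C with
  | nil => simp [Circuit.toMatrix]
  | cons g C ih => simp [Circuit.toMatrix, ih, mul_assoc]

theorem Circuit.append_mulVec (C D : Circuit Q) (v : (Q → Fin 2) → ℂ) :
    (Circuit.toMatrix (C ++ D)).mulVec v = D.toMatrix.mulVec (C.toMatrix.mulVec v) := by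
  rw [Circuit.toMatrix_append, Matrix.mulVec_mulVec]

theorem Circuit.singleton_toMatrix (g : Gate Q) : Circuit.toMatrix [g] = g.toMatrix := by
  simp [Circuit.toMatrix]

theorem Circuit.inv_toMatrix (C : Circuit Q) : C.inv.toMatrix = C.toMatrix.conjTranspose := by
  induction C with
  | nil => simp [Circuit.inv, Circuit.toMatrix]
  | cons g C ih =>
    have h : Circuit.inv (g :: C) = Circuit.inv C ++ [g.inv] := by simp [Circuit.inv]
    rw [h, Circuit.toMatrix_append, Circuit.singleton_toMatrix, ih, Circuit.toMatrix,
      Matrix.conjTranspose_mul, Gate.inv_toMatrix]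

theorem Circuit.conjTranspose_mul_self (C : Circuit Q) :
    C.toMatrix.conjTranspose * C.toMatrix = 1 := by
  induction C with
  | nil => simp [Circuit.toMatrix]
  | cons g C ih =>
    rw [Circuit.toMatrix, Matrix.conjTranspose_mul, mul_assoc, ← mul_assoc _ (Circuit.toMatrix C), ih, one_mul,
      ← Gate.inv_toMatrix, Gate.inv_toMatrix_mul]

theorem Circuit.inv_mulVec (C : Circuit Q) (v : (Q → Fin 2) → ℂ) :
    C.inv.toMatrix.mulVec (C.toMatrix.mulVec v) = v := by
  rw [Matrix.mulVec_mulVec, Circuit.inv_toMatrix, Circuit.conjTranspose_mul_self,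
    Matrix.one_mulVec]

theorem Circuit.star_mulVec_dotProduct (C : Circuit Q) (v w : (Q → Fin 2) → ℂ) :
    star (C.toMatrix.mulVec v) ⬝ᵥ C.toMatrix.mulVec w = star v ⬝ᵥ w := by
  rw [Matrix.star_mulVec, ← Matrix.dotProduct_mulVec, Matrix.mulVec_mulVec,
    Circuit.conjTranspose_mul_self, Matrix.one_mulVec]

/-! ### Multiplexed rotations and diagonal unitaries. -/

/-- Multiplexed rotations: a one-parameter group of one-qubit unitaries that is inverted by
conjugation with the bit flip, with the angle depending on the qubits in `T`, costs fewer than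
`2 * 2 ^ #T` CNOTs. -/
theorem exists_multiplexed_circuit (R : ℝ → Matrix.unitaryGroup (Fin 2) ℂ)
    (hadd : ∀ a b, R (a + b) = R a * R b)
    (hflip : ∀ a i j, (R a : Matrix (Fin 2) (Fin 2) ℂ) (i + 1) (j + 1) =
      (R (-a) : Matrix (Fin 2) (Fin 2) ℂ) i j)
    (q : Q) (T : Finset Q) (hq : q ∉ T) (θ : (Q → Fin 2) → ℝ) (hθ : DependsOn θ (T : Set Q)) :
    ∃ C : Circuit Q, C.cnotCount + 2 ≤ 2 * 2 ^ T.card ∧ ∀ v x, C.toMatrix.mulVec v x =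
      ∑ b, (R (θ x) : Matrix (Fin 2) (Fin 2) ℂ) (x q) b * v (update x q b) := by
  induction T using Finset.induction_on generalizing θ with
  | empty =>
    refine ⟨[.single q (R (θ 0))], by simp [Circuit.cnotCount, Gate.cnotCost], fun v x => ?_⟩
    rw [Circuit.singleton_toMatrix, Gate.single_mulVec, hθ (x := 0) (y := x) (by simp)]
  | insert c T hc ih =>
    simp only [Finset.mem_insert, not_or] at hq
    obtain ⟨hqc, hqT⟩ := hq
    have hupd : ∀ i : Fin 2, DependsOn (fun x => θ (update x c i)) (T : Set Q) := by
      intro i x y hxy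
      refine hθ fun r hr => ?_
      by_cases h : r = c
      · subst h; simp
      · have : r ∈ T := by simpa [h] using hr
        simpa [h] using hxy r this
    obtain ⟨A, hA, hA'⟩ := ih hqT (fun x => (θ (update x c 0) + θ (update x c 1)) / 2)
      (fun x y hxy => by
        have h0 := hupd 0 hxy
        have h1 := hupd 1 hxy
        simp only at h0 h1 ⊢
        rw [h0, h1])
    obtain ⟨B, hB, hB'⟩ := ih hqT (fun x => (θ (update x c 0) - θ (update x c 1)) / 2)
      (fun x y hxy => by
        have h0 := hupd 0 hxy
        have h1 := hupd 1 hxy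
        simp only at h0 h1 ⊢
        rw [h0, h1])
    have hcq : c ≠ q := Ne.symm hqc
    -- For `c = 0` the CNOTs are idle and the angles add up to `α + β`; for `c = 1` they conjugate
    -- `B` by the bit flip, giving `α - β`. The slack `+ 2` in the bound, available once from `A`
    -- and once from `B`, pays for the two CNOTs and leaves 2 over.
    refine ⟨[Gate.cnot c q hcq] ++ B ++ [Gate.cnot c q hcq] ++ A, ?_, fun v x => ?_⟩
    · simp only [Circuit.cnotCount_append]
      simp only [Circuit.cnotCount, Gate.cnotCost, List.map_cons, List.map_nil, List.sum_cons,
        List.sum_nil] at hA hB ⊢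
      rw [Finset.card_insert_of_notMem hc, pow_succ]
      omega
    · simp only [Circuit.append_mulVec, Circuit.singleton_toMatrix, hA', hB', Gate.cnot_mulVec]
      have hv : ∀ b d : Fin 2, update (update x q b) c d = update (update x c d) q b :=
        fun b d => update_comm hqc _ _ _
      have hθq : ∀ b d : Fin 2, θ (update (update x c d) q b) = θ (update x c d) := by
        intro b d
        refine hθ fun r hr => ?_
        have : r ≠ q := by
          rintro rfl
          simp [hqc, hqT] at hr
        simp [this]
      simp only [hv, hθq, update_self, update_idem, update_of_ne hcq]
      set α := (θ (update x c 0) + θ (update x c 1)) / 2 with hα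
      set β := (θ (update x c 0) - θ (update x c 1)) / 2 with hβ
      have hx : θ x = θ (update x c (x c)) := by simp
      rcases Fin.exists_fin_two.mp ⟨x c, rfl⟩ with h | h
      · rw [h] at hx ⊢
        have e : θ x = α + β := by rw [hx, hα, hβ]; ring
        simp only [e, hadd, Submonoid.coe_mul, Matrix.mul_apply, Fin.sum_univ_two, add_zero]
        ring
      · rw [h] at hx ⊢
        have e : θ x = α + -β := by rw [hx, hα, hβ]; ring
        simp only [e, hadd, Submonoid.coe_mul, Matrix.mul_apply, ← hflip, Fin.sum_univ_two, zero_add,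
          Fin.reduceAdd]
        ring

/-- The rotation `diag(e^{-ia}, e^{ia})`. -/
noncomputable def rotZ (a : ℝ) : Matrix.unitaryGroup (Fin 2) ℂ :=
  ⟨!![Complex.exp (-(a * Complex.I)), 0; 0, Complex.exp (a * Complex.I)], by
    rw [Matrix.mem_unitaryGroup_iff, Matrix.star_eq_conjTranspose]
    ext i j
    fin_cases i <;> fin_cases j <;>
      simp [Matrix.mul_apply, Fin.sum_univ_two, ← Complex.exp_conj, ← Complex.exp_add]⟩

/-- The real rotation by the angle `a`. -/
noncomputable def rotY (a : ℝ) : Matrix.unitaryGroup (Fin 2) ℂ :=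
  ⟨!![(Real.cos a : ℂ), -(Real.sin a : ℂ); (Real.sin a : ℂ), (Real.cos a : ℂ)], by
    rw [Matrix.mem_unitaryGroup_iff, Matrix.star_eq_conjTranspose]
    have h : (Real.cos a : ℂ) * Real.cos a + Real.sin a * Real.sin a = 1 := by
      have := Real.cos_sq_add_sin_sq a
      rw [← Complex.ofReal_mul, ← Complex.ofReal_mul, ← Complex.ofReal_add]
      norm_cast
      nlinarith
    ext i j
    fin_cases i <;> fin_cases j <;>
      simp [Matrix.mul_apply, Fin.sum_univ_two, -Complex.ofReal_cos, -Complex.ofReal_sin,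
        Complex.conj_ofReal] <;> first | linear_combination h | ring⟩

theorem rotZ_add (a b : ℝ) : rotZ (a + b) = rotZ a * rotZ b := by
  ext i j
  fin_cases i <;> fin_cases j <;>
    simp [rotZ, ← Complex.exp_add] <;> ring_nf

theorem rotZ_flip (a : ℝ) (i j : Fin 2) :
    (rotZ a : Matrix (Fin 2) (Fin 2) ℂ) (i + 1) (j + 1) =
      (rotZ (-a) : Matrix (Fin 2) (Fin 2) ℂ) i j := by
  fin_cases i <;> fin_cases j <;> simp [rotZ]

theorem rotY_add (a b : ℝ) : rotY (a + b) = rotY a * rotY b := by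
  ext i j
  fin_cases i <;> fin_cases j <;>
    simp [rotY, Complex.sin_add, Complex.cos_add] <;> ring_nf

theorem rotY_flip (a : ℝ) (i j : Fin 2) :
    (rotY a : Matrix (Fin 2) (Fin 2) ℂ) (i + 1) (j + 1) =
      (rotY (-a) : Matrix (Fin 2) (Fin 2) ℂ) i j := by
  fin_cases i <;> fin_cases j <;> simp [rotY]

/-- Diagonal unitaries whose phases depend on the qubits in `T`. -/
theorem exists_diagonal_circuit [Nonempty Q] (T : Finset Q) (θ : (Q → Fin 2) → ℝ)
    (hθ : DependsOn θ (T : Set Q)) :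
    ∃ C : Circuit Q, C.cnotCount ≤ 2 * 2 ^ T.card ∧
      ∀ v x, C.toMatrix.mulVec v x = Complex.exp (θ x * Complex.I) * v x := by
  induction T using Finset.induction_on generalizing θ with
  | empty =>
    obtain ⟨q⟩ := ‹Nonempty Q›
    -- A constant phase is a scalar gate, which needs some qubit to act on.
    let u : Matrix.unitaryGroup (Fin 2) ℂ :=
      ⟨Complex.exp (θ 0 * Complex.I) • 1, by
        rw [Matrix.mem_unitaryGroup_iff, Matrix.star_eq_conjTranspose, Matrix.conjTranspose_smul,
          smul_mul_smul_comm]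
        simp [← Complex.exp_conj, ← Complex.exp_add]⟩
    refine ⟨[.single q u], by simp [Circuit.cnotCount, Gate.cnotCost], fun v x => ?_⟩
    rw [Circuit.singleton_toMatrix, Gate.single_mulVec, hθ (x := x) (y := 0) (by simp)]
    simp [u, Matrix.one_apply]
  | insert q T hq ih =>
    have hupd : ∀ i : Fin 2, DependsOn (fun x => θ (update x q i)) (T : Set Q) := by
      intro i x y hxy
      refine hθ fun r hr => ?_
      by_cases h : r = q
      · subst h; simp
      · have : r ∈ T := by simpa [h] using hr
        simpa [h] using hxy r this
    -- The mean of the two phases no longer involves `q`; half their difference is a multiplexed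
    -- `rotZ` on `q`.
    obtain ⟨A, hA, hA'⟩ := ih (fun x => (θ (update x q 1) + θ (update x q 0)) / 2)
      (fun x y hxy => by
        have h0 := hupd 0 hxy
        have h1 := hupd 1 hxy
        simp only at h0 h1 ⊢
        rw [h0, h1])
    obtain ⟨B, hB, hB'⟩ := exists_multiplexed_circuit rotZ rotZ_add rotZ_flip q T hq
      (fun x => (θ (update x q 1) - θ (update x q 0)) / 2)
      (fun x y hxy => by
        have h0 := hupd 0 hxy
        have h1 := hupd 1 hxy
        simp only at h0 h1 ⊢
        rw [h0, h1])
    refine ⟨B ++ A, ?_, fun v x => ?_⟩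
    · rw [Circuit.cnotCount_append, Finset.card_insert_of_notMem hq, pow_succ]
      omega
    · rw [Circuit.append_mulVec, hA', hB']
      have hx : θ x = θ (update x q (x q)) := by simp
      have hv : v x = v (update x q (x q)) := by simp
      rcases Fin.exists_fin_two.mp ⟨x q, rfl⟩ with h | h
      · rw [h] at hx hv ⊢
        rw [hx, hv]
        simp [rotZ, Fin.sum_univ_two, ← mul_assoc, ← Complex.exp_add]
        left
        ring_nf
      · rw [h] at hx hv ⊢
        rw [hx, hv]
        simp [rotZ, Fin.sum_univ_two, ← mul_assoc, ← Complex.exp_add]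
        left
        ring_nf

/-! ### State preparation. -/

/-- A pair of amplitudes is rotated so that the second one vanishes. -/
theorem exists_rotation_angles (a b : ℂ) : ∃ φ θ : ℝ,
    (Real.sin θ : ℂ) * (Complex.exp (-(φ * Complex.I)) * a) +
      Real.cos θ * (Complex.exp (φ * Complex.I) * b) = 0 := by
  -- `φ` brings both amplitudes to the mean argument; `θ` then turns the real vector `(‖a‖, ‖b‖)`
  -- onto the first axis.
  refine ⟨(a.arg - b.arg) / 2, -(Complex.mk ‖a‖ ‖b‖).arg, ?_⟩
  set z := Complex.mk ‖a‖ ‖b‖ with hz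
  have ha : ‖a‖ = ‖z‖ * Real.cos z.arg := by rw [Complex.norm_mul_cos_arg]
  have hb : ‖b‖ = ‖z‖ * Real.sin z.arg := by rw [Complex.norm_mul_sin_arg]
  have ea : Complex.exp (-(((a.arg - b.arg) / 2 : ℝ) * Complex.I)) * a =
      ‖a‖ * Complex.exp ((a.arg + b.arg) / 2 * Complex.I) := by
    conv_lhs => rw [← Complex.norm_mul_exp_arg_mul_I a]
    rw [mul_left_comm, ← Complex.exp_add]
    simp only [Complex.norm_mul_exp_arg_mul_I]
    push_cast
    ring_nf
  have eb : Complex.exp (((a.arg - b.arg) / 2 : ℝ) * Complex.I) * b =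
      ‖b‖ * Complex.exp ((a.arg + b.arg) / 2 * Complex.I) := by
    conv_lhs => rw [← Complex.norm_mul_exp_arg_mul_I b]
    rw [mul_left_comm, ← Complex.exp_add]
    simp only [Complex.norm_mul_exp_arg_mul_I]
    push_cast
    ring_nf
  rw [ea, eb, ha, hb, Real.sin_neg, Real.cos_neg]
  push_cast
  ring

/-- State preparation: a vector whose support is a subcube with free qubits `T` is mapped to a
multiple of a basis state. -/
theorem exists_disentangling_circuit (T : Finset Q) (v : (Q → Fin 2) → ℂ)
    (hv : ∀ x, (∃ r, r ∉ T ∧ x r ≠ 0) → v x = 0) :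
    ∃ C : Circuit Q, C.cnotCount ≤ 4 * 2 ^ T.card ∧
      ∀ x, x ≠ 0 → C.toMatrix.mulVec v x = 0 := by
  induction T using Finset.induction_on generalizing v with
  | empty =>
    refine ⟨[], by simp [Circuit.cnotCount], fun x hx => ?_⟩
    obtain ⟨r, hr⟩ := Function.ne_iff.mp hx
    simpa [Circuit.toMatrix] using hv x ⟨r, by simp, hr⟩
  | insert q T hq ih =>
    -- Reading `v` only at masked points makes the chosen angles depend on `T` alone.
    let mask : (Q → Fin 2) → (Q → Fin 2) := fun x r => if r ∈ T then x r else 0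
    have hmask : ∀ x y : Q → Fin 2, (∀ r ∈ (T : Set Q), x r = y r) → mask x = mask y := by
      intro x y h
      ext r
      by_cases hr : r ∈ T
      · simp [mask, hr, h r hr]
      · simp [mask, hr]
    choose φ θ h using fun x : Q → Fin 2 =>
      exists_rotation_angles (v (update (mask x) q 0)) (v (update (mask x) q 1))
    have hφ : DependsOn (fun x => φ (mask x)) (T : Set Q) := fun x y hxy => by
      simp only [hmask x y hxy]
    have hθ : DependsOn (fun x => θ (mask x)) (T : Set Q) := fun x y hxy => by
      simp only [hmask x y hxy]
    obtain ⟨A, hA, hA'⟩ := exists_multiplexed_circuit rotZ rotZ_add rotZ_flip q T hq _ hφ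
    obtain ⟨B, hB, hB'⟩ := exists_multiplexed_circuit rotY rotY_add rotY_flip q T hq _ hθ
    -- The support shrinks to the subcube of `T`. If a qubit outside `insert q T` is nonzero, both
    -- mixed amplitudes were already zero; otherwise `x q = 1`, and the angles were chosen to kill
    -- that amplitude.
    have hAB : ∀ x, (∃ r, r ∉ T ∧ x r ≠ 0) →
        B.toMatrix.mulVec (A.toMatrix.mulVec v) x = 0 := by
      rintro x ⟨r, hrT, hr⟩
      have hmm : ∀ b, mask (update x q b) = mask x := fun b =>
        hmask _ _ fun s hs => by
          have : s ≠ q := by rintro rfl; exact hq hs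
          simp [this]
      simp only [hB', hA', hmm, update_self, update_idem, Fin.sum_univ_two]
      by_cases hx : ∃ r, r ∉ insert q T ∧ x r ≠ 0
      · have h0 : ∀ b, v (update x q b) = 0 := by
          intro b
          obtain ⟨s, hs, hsx⟩ := hx
          refine hv _ ⟨s, hs, ?_⟩
          have : s ≠ q := by rintro rfl; simp at hs
          simpa [this] using hsx
        simp [h0]
      · push Not at hx
        have hrq : r = q := by
          by_contra hne
          exact hr (hx r (by simp [hne, hrT]))
        subst hrq
        have hr1 : x r = 1 := by
          have : ∀ i : Fin 2, i ≠ 0 → i = 1 := by decide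
          exact this _ hr
        have hm : ∀ b, update x r b = update (mask (mask x)) r b := by
          intro b
          ext s
          by_cases hs : s = r
          · subst hs; simp
          · by_cases hsT : s ∈ T
            · simp [hs, mask, hsT]
            · simp [hs, mask, hsT, hx s (by simp [hs, hsT])]
        have hm2 : mask (mask x) = mask x := hmask _ _ fun s hs => by
          have : s ∈ T := hs
          simp [mask, this]
        have := h (mask x)
        simp only [hm2] at hm this
        simp only [hm, hr1]
        simpa [rotY, rotZ] using this
    obtain ⟨D, hD, hD'⟩ := ih _ hAB
    refine ⟨A ++ B ++ D, ?_, fun x hx => ?_⟩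
    · simp only [Circuit.cnotCount_append]
      rw [Finset.card_insert_of_notMem hq, pow_succ]
      omega
    · rw [Circuit.append_mulVec, Circuit.append_mulVec, hD' x hx]

/-! ### Householder reflections. -/

/-- Complex reflections `1 + (e^{ia} - 1) v v†`. -/
theorem exists_reflection_circuit [Nonempty Q] (v : (Q → Fin 2) → ℂ) (a : ℝ) :
    ∃ C : Circuit Q, C.cnotCount ≤ 10 * 2 ^ Fintype.card Q ∧
      ∀ u, (star v ⬝ᵥ v) • C.toMatrix.mulVec u = (star v ⬝ᵥ v) • u +
        ((Complex.exp (a * Complex.I) - 1) * (star v ⬝ᵥ u)) • v := by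
  -- `P` sends `v` to `c|0⟩` with `star c * c = star v ⬝ᵥ v`; stating the result scaled by this
  -- number avoids normalizing `v`. The constant is 4 + 2 + 4, for `P`, `D` and `P.inv`.
  obtain ⟨P, hP, hP'⟩ := exists_disentangling_circuit Finset.univ v (by simp)
  obtain ⟨D, hD, hD'⟩ := exists_diagonal_circuit (Q := Q) Finset.univ
    (fun x => if x = 0 then a else 0) (fun x y h => by
      have : x = y := funext fun r => h r (by simp)
      rw [this])
  rw [Finset.card_univ] at hP hD
  refine ⟨P ++ D ++ P.inv, ?_, fun u => ?_⟩
  · simp only [Circuit.cnotCount_append, Circuit.cnotCount_inv]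
    omega
  · rw [Circuit.append_mulVec, Circuit.append_mulVec]
    have hPv : P.toMatrix.mulVec v = Pi.single 0 (P.toMatrix.mulVec v 0) := by
      ext x
      by_cases hx : x = 0
      · subst hx; simp
      · simp [hx, hP' x hx]
    set c := P.toMatrix.mulVec v 0
    have hvv : star v ⬝ᵥ v = star c * c := by
      rw [← P.star_mulVec_dotProduct, hPv, ← Pi.single_star, single_dotProduct]
      simp
    have hvu : star v ⬝ᵥ u = star c * P.toMatrix.mulVec u 0 := by
      rw [← P.star_mulVec_dotProduct, hPv, ← Pi.single_star, single_dotProduct]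
    have key : (star v ⬝ᵥ v) • D.toMatrix.mulVec (P.toMatrix.mulVec u) =
        P.toMatrix.mulVec ((star v ⬝ᵥ v) • u +
          ((Complex.exp (a * Complex.I) - 1) * (star v ⬝ᵥ u)) • v) := by
      rw [Matrix.mulVec_add, Matrix.mulVec_smul, Matrix.mulVec_smul, hPv, hvv, hvu]
      ext x
      by_cases hx : x = 0
      · subst hx
        simp [hD', -Matrix.mulVec_mulVec]
        ring
      · simp [hD', hx, -Matrix.mulVec_mulVec]
    rw [← Matrix.mulVec_smul, key, Circuit.inv_mulVec]

theorem dotProduct_star_comm (v w : (Q → Fin 2) → ℂ) :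
    star w ⬝ᵥ v = star (star v ⬝ᵥ w) := by
  rw [Matrix.star_dotProduct]

/-- Householder step: a unit vector is mapped to another one, fixing what is orthogonal to both. -/
theorem exists_householder_circuit [Nonempty Q] (w e : (Q → Fin 2) → ℂ)
    (hw : star w ⬝ᵥ w = 1) (he : star e ⬝ᵥ e = 1) :
    ∃ C : Circuit Q, C.cnotCount ≤ 10 * 2 ^ Fintype.card Q ∧ C.toMatrix.mulVec w = e ∧
      ∀ u, star w ⬝ᵥ u = 0 → star e ⬝ᵥ u = 0 → C.toMatrix.mulVec u = u := by
  by_cases hwe : w = e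
  · exact ⟨[], by simp [Circuit.cnotCount], by simp [Circuit.toMatrix, hwe],
      by simp [Circuit.toMatrix]⟩
  have hv0 : star (w - e) ⬝ᵥ (w - e) ≠ 0 := by
    rw [Ne, dotProduct_star_self_eq_zero, sub_eq_zero]
    exact hwe
  set z := star e ⬝ᵥ w with hz
  have hz' : star w ⬝ᵥ e = star z := dotProduct_star_comm e w
  have hvv : star (w - e) ⬝ᵥ (w - e) = (1 - z) + (1 - star z) := by
    simp only [star_sub, sub_dotProduct, dotProduct_sub, hw, he, ← hz, hz']
    ring
  have hvw : star (w - e) ⬝ᵥ w = 1 - z := by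
    simp only [star_sub, sub_dotProduct, hw, ← hz]
  have hz1 : 1 - z ≠ 0 := by
    intro h
    apply hv0
    have : 1 - star z = star (1 - z) := by simp
    rw [hvv, this, h]; simp
  -- Solves `(e^{ia} - 1)⟨w - e, w⟩ = -⟨w - e, w - e⟩`, the condition for `w ↦ e`. The usual
  -- reflection, `e^{ia} = -1`, would do only for real `z`.
  obtain ⟨a, ha⟩ : ∃ a : ℝ, Complex.exp (a * Complex.I) = -(1 - star z) / (1 - z) := by
    refine (Complex.norm_eq_one_iff _).mp ?_
    have : 1 - star z = star (1 - z) := by simp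
    rw [norm_div, norm_neg, this, norm_star, div_self (norm_ne_zero_iff.mpr hz1)]
  obtain ⟨C, hC, hC'⟩ := exists_reflection_circuit (w - e) a
  refine ⟨C, hC, ?_, fun u hwu heu => ?_⟩
  · refine smul_right_injective _ hv0 ?_
    have hcoef : (Complex.exp (a * Complex.I) - 1) * (star (w - e) ⬝ᵥ w) =
        -(star (w - e) ⬝ᵥ (w - e)) := by
      rw [hvv, hvw, ha]
      field_simp
      ring
    simp only [hC', hcoef, neg_smul, smul_sub]
    abel
  · refine smul_right_injective _ hv0 ?_
    have : star (w - e) ⬝ᵥ u = 0 := by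
      rw [star_sub, sub_dotProduct, hwu, heu, sub_zero]
    simp only [hC', this, mul_zero, zero_smul, add_zero]

/-- An orthonormal family is mapped to another one, one vector at a time. -/
theorem exists_circuit_mulVec_eq [Nonempty Q] {N : ℕ} (w e : Fin N → (Q → Fin 2) → ℂ)
    (hw : ∀ i j, star (w i) ⬝ᵥ w j = if i = j then 1 else 0)
    (he : ∀ i j, star (e i) ⬝ᵥ e j = if i = j then 1 else 0) (k : ℕ) (hk : k ≤ N) :
    ∃ C : Circuit Q, C.cnotCount ≤ k * (10 * 2 ^ Fintype.card Q) ∧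
      ∀ i : Fin N, i.val < k → C.toMatrix.mulVec (w i) = e i := by
  induction k with
  | zero => exact ⟨[], by simp [Circuit.cnotCount], by simp⟩
  | succ k ih =>
    obtain ⟨C, hC, hC'⟩ := ih (by omega)
    let j : Fin N := ⟨k, hk⟩
    -- Columns already placed stay put: each `e i` with `i < k` is orthogonal to `e j` and, by
    -- unitarity of `C`, to the image of `w j`.
    obtain ⟨R, hR, hRj, hRu⟩ := exists_householder_circuit (C.toMatrix.mulVec (w j)) (e j)
      (by rw [C.star_mulVec_dotProduct, hw, if_pos rfl]) (by rw [he, if_pos rfl])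
    refine ⟨C ++ R, ?_, fun i hi => ?_⟩
    · rw [Circuit.cnotCount_append, add_one_mul]
      exact add_le_add hC hR
    · rw [Circuit.append_mulVec]
      by_cases hij : i = j
      · rw [hij, hRj]
      · have hik : i.val < k := by
          have : i.val ≠ k := fun h => hij (Fin.ext h)
          omega
        rw [← hC' i hik]
        refine hRu _ ?_ ?_
        · rw [C.star_mulVec_dotProduct, hw, if_neg (Ne.symm hij)]
        · rw [hC' i hik, he, if_neg (Ne.symm hij)]

end Circuits

/-! ### Isometry synthesis and the compressor count. -/

/-- Isometries from `m` to `s` qubits are synthesized with `O(2 ^ (m + s))` CNOTs. -/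
theorem exists_encodesInverse {s m : ℕ} (hs : 1 ≤ s) (h : m ≤ s)
    (W : Matrix (Fin (2 ^ s)) (Fin (2 ^ m)) ℂ) (hW : W.conjTranspose * W = 1) :
    ∃ C : Circuit (Fin s), C.cnotCount ≤ 10 * 2 ^ (m + s) ∧ EncodesInverse h C W := by
  have : Nonempty (Fin s) := ⟨⟨0, hs⟩⟩
  obtain ⟨C, hC, hC'⟩ := exists_circuit_mulVec_eq (Q := Fin s)
    (fun (j : Fin (2 ^ m)) x => W (finFunctionFinEquiv x) j)
    (fun j => Pi.single (bits s (Fin.castLE (Nat.pow_le_pow_right two_pos h) j)) 1)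
    (fun i j => by
      have := congrFun (congrFun hW i) j
      rw [Matrix.mul_apply, Matrix.one_apply] at this
      rw [← this]
      exact Fintype.sum_equiv finFunctionFinEquiv _ _ fun x => rfl)
    (fun i j => by
      rw [← Pi.single_star, single_dotProduct, star_one, one_mul, Pi.single_apply]
      simp [bits])
    (2 ^ m) le_rfl
  refine ⟨C, hC.trans (le_of_eq ?_), fun j => hC' j j.isLt⟩
  rw [Fintype.card_fin, pow_add]
  ring

/-- A synthesis method that picks a circuit with `O(2 ^ (m + s))` CNOTs for every isometry. -/
noncomputable def householderSynthesis : Synthesis := by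
  classical
  exact fun s m W =>
    -- Elsewhere the empty circuit is a junk value, since correctness only concerns these inputs. A
    -- register with no qubits has no gates, so it could not even correct a phase.
    if H : 1 ≤ s ∧ m ≤ s ∧ W.conjTranspose * W = 1 then
      (exists_encodesInverse H.1 H.2.1 W H.2.2).choose
    else []

theorem householderSynthesis_spec {s m : ℕ} (hs : 1 ≤ s) (h : m ≤ s)
    (W : Matrix (Fin (2 ^ s)) (Fin (2 ^ m)) ℂ) (hW : W.conjTranspose * W = 1) :
    (householderSynthesis s m W).cnotCount ≤ 10 * 2 ^ (m + s) ∧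
      EncodesInverse h (householderSynthesis s m W) W := by
  have H : 1 ≤ s ∧ m ≤ s ∧ W.conjTranspose * W = 1 := ⟨hs, h, hW⟩
  rw [householderSynthesis, dif_pos H]
  exact (exists_encodesInverse hs h W hW).choose_spec

theorem firstColumns_isometry {s m : ℕ} (h : m ≤ s) {U : Matrix (Fin (2 ^ s)) (Fin (2 ^ s)) ℂ}
    (hU : U ∈ Matrix.unitaryGroup (Fin (2 ^ s)) ℂ) :
    (firstColumns m h U).conjTranspose * firstColumns m h U = 1 := by
  rw [Matrix.mem_unitaryGroup_iff', Matrix.star_eq_conjTranspose] at hU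
  have hinj : Injective (Fin.castLE (Nat.pow_le_pow_right two_pos h) : Fin (2 ^ m) → Fin (2 ^ s)) :=
    Fin.castLE_injective _
  rw [firstColumns, Matrix.conjTranspose_submatrix,
    ← Matrix.submatrix_mul _ _ _ id _ bijective_id, hU, Matrix.submatrix_one _ hinj]

theorem map_conj_mem_unitaryGroup {n : ℕ} {V : Matrix (Fin n) (Fin n) ℂ}
    (hV : V ∈ Matrix.unitaryGroup (Fin n) ℂ) :
    V.map (starRingEnd ℂ) ∈ Matrix.unitaryGroup (Fin n) ℂ := by
  rw [Matrix.mem_unitaryGroup_iff, Matrix.star_eq_conjTranspose] at hV ⊢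
  have h : (V.map (starRingEnd ℂ)).conjTranspose = V.conjTranspose.map (starRingEnd ℂ) := by
    ext i j; simp
  rw [h, ← Matrix.map_mul, hV]
  simp

theorem cnotCount_map {P Q : Type} (f : P ↪ Q) (C : Circuit P) :
    Circuit.cnotCount (List.map (Gate.map f) C) = C.cnotCount := by
  have h : (Gate.cnotCost ∘ Gate.map f : Gate P → ℕ) = Gate.cnotCost := by
    ext g; cases g <;> rfl
  simp [Circuit.cnotCount, h]

theorem cnotCount_cnotLayer {n nA nB : ℕ} (e : Fin nA ⊕ Fin nB ≃ Fin n) (m : ℕ) (hA : m ≤ nA)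
    (hB : m ≤ nB) : (cnotLayer e m hA hB).cnotCount = m := by
  simp [Circuit.cnotCount, cnotLayer, List.map_ofFn, Function.comp_def, Gate.cnotCost]

/-- 21 is 10 for block A, 10 for block B (using `nB ≤ nA`), and 1 for the final layer, since `m < 2
^ m`. -/
theorem cnotCount_compressor_le {n nA nB : ℕ} (e : Fin nA ⊕ Fin nB ≃ Fin n) (h1 : 1 ≤ nB)
    (hBA : nB ≤ nA) {U : Matrix (Fin (2 ^ nA)) (Fin (2 ^ nA)) ℂ}
    (σ : Fin (min (2 ^ nA) (2 ^ nB)) → ℝ) {V : Matrix (Fin (2 ^ nB)) (Fin (2 ^ nB)) ℂ}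
    (hU : U ∈ Matrix.unitaryGroup (Fin (2 ^ nA)) ℂ)
    (hV : V ∈ Matrix.unitaryGroup (Fin (2 ^ nB)) ℂ) :
    (compressor householderSynthesis e U σ V).cnotCount ≤
      21 * 2 ^ (schmidtMeasure σ + nA) := by
  have hA := (householderSynthesis_spec (h1.trans hBA) (schmidtMeasure_le_left σ) _
    (firstColumns_isometry (schmidtMeasure_le_left σ) hU)).1
  have hB := (householderSynthesis_spec h1 (schmidtMeasure_le_right σ) _
    (firstColumns_isometry (schmidtMeasure_le_right σ) (map_conj_mem_unitaryGroup hV))).1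
  have hpow : 2 ^ (schmidtMeasure σ + nB) ≤ 2 ^ (schmidtMeasure σ + nA) :=
    Nat.pow_le_pow_right two_pos (by omega)
  have hm : schmidtMeasure σ ≤ 2 ^ (schmidtMeasure σ + nA) :=
    (Nat.lt_two_pow_self).le.trans (Nat.pow_le_pow_right two_pos (by omega))
  simp only [compressor, Circuit.cnotCount_append, cnotCount_map, cnotCount_cnotLayer]
  omega

end SQC

theorem theorem1 :
    ∃ S : SQC.Synthesis, S.Correct ∧
      ∃ K : ℝ, ∀ (n nA nB : ℕ) (e : Fin nA ⊕ Fin nB ≃ Fin n) (_ : 1 ≤ nB) (_ : nB ≤ nA)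
        (ψ : EuclideanSpace ℂ (Fin n → Fin 2)) (_ : ‖ψ‖ = 1)
        (U : Matrix (Fin (2 ^ nA)) (Fin (2 ^ nA)) ℂ) (σ : Fin (min (2 ^ nA) (2 ^ nB)) → ℝ)
        (V : Matrix (Fin (2 ^ nB)) (Fin (2 ^ nB)) ℂ) (_ : SQC.IsSVD (SQC.reshape e ψ) U σ V),
        (SQC.schmidtMeasure σ < nB →
          ((SQC.compressor S e U σ V).cnotCount : ℝ) ≤ K * 2 ^ (SQC.schmidtMeasure σ + nA)) ∧
        (SQC.schmidtMeasure σ = nB →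
          ((SQC.compressor S e U σ V).cnotCount : ℝ) ≤ K * 2 ^ n) := by
  refine ⟨SQC.householderSynthesis,
    fun s m hs h W hW => (SQC.householderSynthesis_spec hs h W hW).2, 21, ?_⟩
  intro n nA nB e h1 hBA ψ _ U σ V hsvd
  have hbound : ((SQC.compressor SQC.householderSynthesis e U σ V).cnotCount : ℝ) ≤
      21 * 2 ^ (SQC.schmidtMeasure σ + nA) := by
    exact_mod_cast SQC.cnotCount_compressor_le e h1 hBA σ hsvd.unitary_left hsvd.unitary_right
  refine ⟨fun _ => hbound, fun hm => ?_⟩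
  -- Counting qubits through `e` gives `n = nA + nB`, and here `nB` is the Schmidt measure.
  have hn : n = SQC.schmidtMeasure σ + nA := by
    have := Fintype.card_congr e
    simp only [Fintype.card_sum, Fintype.card_fin] at this
    omega
  rwa [show (2 : ℝ) ^ n = _ from congrArg _ hn]
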